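/- Let $p$ be a prime and let $u,d$ be positive integers, with $u\ge 2$ if $p=2$. For $i\ge 1$ let $\mathrm{CS}(i,d,p)=\{A\in \mathrm{Mat}_d(\mathbb{Z}_p) : A\equiv I_d \bmod p^i\}$, a group under multiplication, and put $\Gamma_n=\mathrm{CS}(u+n-1,d,p)$ for $n\ge 1$ and $\Gamma=\Gamma_1$. Let $k$ be a field of characteristic $p$, and let $k[[\Gamma]]=\varprojlim_n k[\Gamma]/\omega(\Gamma_n)k[\Gamma]$ be the completed group ring, where $\omega(\Gamma_n)$ is the augmentation ideal of $k[\Gamma_n]$. Since $k[\Gamma]/\omega(\Gamma_n)k[\Gamma]\cong k[\Gamma/\Gamma_n]$, there is a natural ring homomorphism $k[[\Gamma]]\to k[\Gamma/\Gamma_n]$ for every $n\ge 1$. Fix $0\ne a\in k[[\Gamma]]$, and for each $n\ge 1$ let $\alpha_n\colon k[\Gamma/\Gamma_n]\to k[\Gamma/\Gamma_n]$ be the $k$-linear map induced by left multiplication by $a$ in $k[[\Gamma]]$, that is, left multiplication by the image of $a$ in $k[\Gamma/\Gamma_n]$. Then $$\lim_{n\to\infty}\frac{\dim_k\ker\alpha_n}{[\Gamma:\Gamma_n]}=0.$$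 -/

import Mathlib

/-- The congruence subgroup `CS(i,d,p)`: the matrices `A` over the `p`-adic integers with
`A ≡ 1` modulo `p ^ i`, as a subgroup of `GL_d(ℤ_p)` (the kernel of reduction modulo `p ^ i`).
For `i ≥ 1` every matrix congruent to `1` modulo `p ^ i` is invertible, so that no matrix
is lost by working inside `GL_d(ℤ_p)`; see `exists_mem_CS_of_congr`. -/
noncomputable def CS (i d p : ℕ) [Fact p.Prime] : Subgroup (GL (Fin d) ℤ_[p]) :=
  (Matrix.GeneralLinearGroup.map (n := Fin d)
    (Ideal.Quotient.mk (Ideal.span {(p : ℤ_[p]) ^ i}))).ker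

theorem mem_CS_iff {i d p : ℕ} [Fact p.Prime] {A : GL (Fin d) ℤ_[p]} :
    A ∈ CS i d p ↔ ∀ r c, (p : ℤ_[p]) ^ i ∣ A.1 r c - (1 : Matrix (Fin d) (Fin d) ℤ_[p]) r c := by
  rw [CS, MonoidHom.mem_ker, Matrix.GeneralLinearGroup.ext_iff]
  refine forall₂_congr fun r c => ?_
  rw [← Ideal.mem_span_singleton, ← Ideal.Quotient.eq]
  simp [Matrix.one_apply, apply_ite (Ideal.Quotient.mk (Ideal.span {(p : ℤ_[p]) ^ i}))]

theorem CS_anti {i j d p : ℕ} [Fact p.Prime] (h : i ≤ j) : CS j d p ≤ CS i d p := fun _ hA =>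
  mem_CS_iff.2 fun r c => (pow_dvd_pow _ h).trans (mem_CS_iff.1 hA r c)

theorem exists_mem_CS_of_congr {i d p : ℕ} [Fact p.Prime] (hi : 0 < i)
    (A : Matrix (Fin d) (Fin d) ℤ_[p])
    (hA : ∀ r c, (p : ℤ_[p]) ^ i ∣ A r c - (1 : Matrix (Fin d) (Fin d) ℤ_[p]) r c) :
    ∃ B ∈ CS i d p, B.1 = A := by
  have hm : A.map (IsLocalRing.residue ℤ_[p]) = 1 := by
    ext r c
    have h1 : A r c - (1 : Matrix (Fin d) (Fin d) ℤ_[p]) r c ∈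
        IsLocalRing.maximalIdeal ℤ_[p] := by
      rw [PadicInt.maximalIdeal_eq_span_p, Ideal.mem_span_singleton]
      exact (dvd_pow_self _ hi.ne').trans (hA r c)
    rw [← IsLocalRing.residue_eq_zero_iff, map_sub, sub_eq_zero] at h1
    rw [Matrix.map_apply, h1]
    by_cases h : r = c
    · subst h; rw [Matrix.one_apply_eq, Matrix.one_apply_eq, map_one]
    · rw [Matrix.one_apply_ne h, Matrix.one_apply_ne h, map_zero]
  have hdet : IsUnit A.det := by
    rw [← isUnit_map_iff (IsLocalRing.residue ℤ_[p]), RingHom.map_det, RingHom.mapMatrix_apply, hm]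
    simp
  exact ⟨Matrix.GeneralLinearGroup.mk'' A hdet, mem_CS_iff.2 hA, rfl⟩

/-- The completion `lim R / I_j` of a ring `R` along a decreasing sequence of two-sided ideals:
the ring of all compatible families in `∏ j, R / I_j`. -/
def ringCompletion {R : Type*} [Ring R] (I : ℕ → TwoSidedIdeal R) (hI : Antitone I) :
    Subring (∀ j, (I j).ringCon.Quotient) where
  carrier := {f | ∀ (i j : ℕ) (h : i ≤ j),
    RingCon.map (I j).ringCon (I i).ringCon (TwoSidedIdeal.ringCon_le_iff.1 (hI h)) (f j) = f i}
  mul_mem' hf hg i j h := by rw [Pi.mul_apply, map_mul, hf i j h, hg i j h, Pi.mul_apply]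
  one_mem' i j h := by simp
  add_mem' hf hg i j h := by rw [Pi.add_apply, map_add, hf i j h, hg i j h, Pi.add_apply]
  zero_mem' i j h := by simp
  neg_mem' hf i j h := by rw [Pi.neg_apply, map_neg, hf i j h, Pi.neg_apply]

/-- The augmentation ideal `ω(G)` of the group ring `k[G]`. -/
noncomputable def augIdeal (k G : Type*) [Field k] [Group G] : TwoSidedIdeal (MonoidAlgebra k G) :=
  TwoSidedIdeal.ker (MonoidAlgebra.lift k k G (1 : G →* k))

/-- The ideal `ω(N) k[G]` of `k[G]`, for a normal subgroup `N` of `G`. As `N` is normal, the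
right ideal generated by `ω(N)` is two-sided, so it is the two-sided ideal generated by `ω(N)`. -/
noncomputable def relAugIdeal (k : Type*) {G : Type*} [Field k] [Group G] (N : Subgroup G) :
    TwoSidedIdeal (MonoidAlgebra k G) :=
  TwoSidedIdeal.span
    (MonoidAlgebra.mapDomainRingHom k N.subtype '' (augIdeal k N : Set (MonoidAlgebra k N)))

theorem relAugIdeal_mono (k : Type*) {G : Type*} [Field k] [Group G] {M N : Subgroup G}
    (h : M ≤ N) : relAugIdeal k M ≤ relAugIdeal k N := by
  refine TwoSidedIdeal.span_mono ?_
  rintro _ ⟨x, hx, rfl⟩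
  refine ⟨MonoidAlgebra.mapDomainRingHom k (Subgroup.inclusion h) x, ?_, ?_⟩
  · have hx' : MonoidAlgebra.lift k k M (1 : M →* k) x = 0 := TwoSidedIdeal.mem_ker _ |>.1 hx
    refine (TwoSidedIdeal.mem_ker _).2 (Eq.trans ?_ hx')
    have : (MonoidAlgebra.lift k k N (1 : N →* k)).toRingHom.comp
        (MonoidAlgebra.mapDomainRingHom k (Subgroup.inclusion h)) =
        (MonoidAlgebra.lift k k M (1 : M →* k)).toRingHom := by
      apply MonoidAlgebra.ringHom_ext <;> intros <;> simp
    exact RingHom.congr_fun this x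
  · have : (MonoidAlgebra.mapDomainRingHom k N.subtype).comp
        (MonoidAlgebra.mapDomainRingHom k (Subgroup.inclusion h)) =
        MonoidAlgebra.mapDomainRingHom k M.subtype := by
      apply MonoidAlgebra.ringHom_ext <;> intros <;> simp
    exact RingHom.congr_fun this x

/-- The natural map `k[G] / ω(N) k[G] → k[G / N]`. -/
noncomputable def quotToGroupRing (k : Type*) {G : Type*} [Field k] [Group G] (N : Subgroup G)
    [N.Normal] : (relAugIdeal k N).ringCon.Quotient →+* MonoidAlgebra k (G ⧸ N) :=
  RingCon.lift (relAugIdeal k N).ringCon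
    (MonoidAlgebra.mapDomainRingHom k (QuotientGroup.mk' N)) <| by
      have key : relAugIdeal k N ≤
          TwoSidedIdeal.ker (MonoidAlgebra.mapDomainRingHom k (QuotientGroup.mk' N)) := by
        refine TwoSidedIdeal.span_le.2 ?_
        rintro _ ⟨x, hx, rfl⟩
        have hx' : MonoidAlgebra.lift k k N (1 : N →* k) x = 0 := TwoSidedIdeal.mem_ker _ |>.1 hx
        refine (TwoSidedIdeal.mem_ker _).2 ?_
        have : (MonoidAlgebra.mapDomainRingHom k (QuotientGroup.mk' N)).comp
            (MonoidAlgebra.mapDomainRingHom k N.subtype) =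
            (algebraMap k (MonoidAlgebra k (G ⧸ N))).comp
              (MonoidAlgebra.lift k k N (1 : N →* k)).toRingHom := by
          apply MonoidAlgebra.ringHom_ext
          · intros; simp
          · intro a
            simp [(QuotientGroup.eq_one_iff (a : G)).2 a.2]
        have h2 := RingHom.congr_fun this x
        refine h2.trans ?_
        change algebraMap k _ (MonoidAlgebra.lift k k N (1 : N →* k) x) = 0
        rw [hx', map_zero]
      exact TwoSidedIdeal.ringCon_le_iff.1 key

section Gamma

variable (u d p : ℕ) [Fact p.Prime]

/-- The group `Γ = CS(u,d,p)`. -/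
abbrev Gam : Type := CS u d p

/-- `GamSub u d p j` is the subgroup `Γ_{j+1} = CS(u+j,d,p)` of `Γ`. (The sequence
`Γ = Γ_1 ⊇ Γ_2 ⊇ ⋯` with `Γ_n = CS(u+n-1,d,p)` is indexed here from `0`.) -/
noncomputable def GamSub (j : ℕ) : Subgroup (Gam u d p) := (CS (u + j) d p).subgroupOf (CS u d p)

instance (j : ℕ) : (GamSub u d p j).Normal :=
  haveI : (CS (u + j) d p).Normal := MonoidHom.normal_ker _
  Subgroup.normal_subgroupOf

theorem antitone_relAugIdeal_GamSub (k : Type*) [Field k] :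
    Antitone fun j => relAugIdeal k (GamSub u d p j) := fun _ _ h =>
  relAugIdeal_mono k (Subgroup.comap_mono (CS_anti (Nat.add_le_add_left h u)))

/-- The completed group ring `k[[Γ]]`: the completion of `k[Γ]` along the ideals
`ω(Γ_n) k[Γ]`, `n ≥ 1`. -/
abbrev CompletedGroupRing (k : Type*) [Field k] : Type _ :=
  ringCompletion (fun j => relAugIdeal k (GamSub u d p j)) (antitone_relAugIdeal_GamSub u d p k)

variable {u d p}

/-- The natural ring homomorphism `k[[Γ]] → k[Γ / Γ_{j+1}]`. -/
noncomputable def completedProj {k : Type*} [Field k] (j : ℕ) :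
    CompletedGroupRing u d p k →+* MonoidAlgebra k (Gam u d p ⧸ GamSub u d p j) :=
  (quotToGroupRing k (GamSub u d p j)).comp
    ((Pi.evalRingHom (fun j => (relAugIdeal k (GamSub u d p j)).ringCon.Quotient) j).comp
      (Subring.subtype _))

/-- The `k`-linear endomorphism of `k[Γ / Γ_{j+1}]` induced by left multiplication by `a` on
`k[[Γ]]`, that is, left multiplication by the image of `a`. -/
noncomputable def inducedLeftMul {k : Type*} [Field k] (a : CompletedGroupRing u d p k) (j : ℕ) :
    MonoidAlgebra k (Gam u d p ⧸ GamSub u d p j) →ₗ[k]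
      MonoidAlgebra k (Gam u d p ⧸ GamSub u d p j) :=
  LinearMap.mulLeft k (completedProj j a)

theorem inducedLeftMul_completedProj {k : Type*} [Field k] (a b : CompletedGroupRing u d p k)
    (j : ℕ) : inducedLeftMul a j (completedProj j b) = completedProj j (a * b) :=
  (map_mul (completedProj j) a b).symm

end Gamma

/-! Filter the group algebra of the finite `p`-group `Γ / Γ_{j+1}` by the powers of its augmentation
ideal. Put `D = d * d` and `q = p ^ j`, and let the `x i` be the `D` elements `g - 1` with `g = 1 +
p ^ u E`, `E` a matrix unit. They generate the filtration in degree one, they commute up to depth 3,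
and `x i ^ q = 0`. So the associated graded algebra is a quotient of the truncated polynomial ring
in `D` variables, and a nonzero leading form of `a`, of degree `m` with leading exponent `μ`,
controls the cokernel of multiplication by `a`: the monomials with exponents below `q` that are not
multiples of `μ` span it (`range_mulLeft_sup_span_eq_top`). There are at most `m * q ^ (D - 1)` of
these (`card_bounded_not_ge_le`). Kernel and cokernel have the same dimension and the index is `q ^
D`, so the ratio is at most `m / q`. Only spanning is used; the monomials need not be known to be
independent.

The bound is useful because `m` and the leading form can be chosen independently of `j`. By
`mk_mem_dimensionSubgroup`, `Γ_{i+1}` has depth at least `p ^ i`, so passing from level `j` down to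
level `i` loses only elements of depth `p ^ i`. Once `p ^ i > m`, a leading form found at level `i`
is a leading form at every later level (`exists_finrank_ker_inducedLeftMul_le`). -/

section Filtration

/-! ### Filtered algebras with commutative associated graded ring -/

variable {k A ι : Type*} [Field k] [Ring A] [Algebra k A]

/-- A multiplicative filtration of an algebra, generated in degree one by elements `x i` that
commute up to higher filtration. -/
structure AlmostCommFiltration (F : ℕ → Submodule k A) (x : ι → A) : Prop where
  zero_eq_top : F 0 = ⊤
  anti : Antitone F
  mul_mem : ∀ {i j : ℕ} {a b : A}, a ∈ F i → b ∈ F j → a * b ∈ F (i + j)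
  gen_mem : ∀ i, x i ∈ F 1
  -- Depth 3, not merely 2, is what makes the degree-one generators commute in the graded ring.
  comm_mem : ∀ i j, x i * x j - x j * x i ∈ F 3
  zero_le : F 0 ≤ Submodule.span k {1} ⊔ F 1
  one_le : F 1 ≤ Submodule.span k (Set.range x) ⊔ F 2
  succ_le : ∀ m, F (m + 1) ≤ F 1 * F m

/-- The product of the `x i`, each taken `s i` times, in some order. -/
noncomputable def orderedMonomial (x : ι → A) (s : ι →₀ ℕ) : A :=
  ((Finsupp.toMultiset s).toList.map x).prod

namespace AlmostCommFiltration

variable {F : ℕ → Submodule k A} {x : ι → A} (h : AlmostCommFiltration F x)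
include h

theorem list_prod_mem (l : List ι) : (l.map x).prod ∈ F l.length := by
  induction l with
  | nil => simp [h.zero_eq_top]
  | cons i l ih =>
    rw [List.map_cons, List.prod_cons, List.length_cons, add_comm]
    exact h.mul_mem (h.gen_mem i) ih

/-- Swapping two neighbours costs a commutator of depth 3 in place of a product of depth 2. Hence
the arbitrary order chosen in `orderedMonomial` is irrelevant modulo deeper terms. -/
theorem list_prod_sub_mem_of_perm {l l' : List ι} (hl : l.Perm l') :
    (l.map x).prod - (l'.map x).prod ∈ F (l.length + 1) := by
  induction hl with
  | nil => simp
  | cons i _ ih =>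
    rw [List.map_cons, List.prod_cons, List.map_cons, List.prod_cons, ← mul_sub, List.length_cons,
      add_right_comm, add_comm]
    exact h.mul_mem (h.gen_mem i) (by simpa using ih)
  | swap i j l =>
    have := h.mul_mem (h.comm_mem j i) (h.list_prod_mem l)
    simp only [List.map_cons, List.prod_cons, List.length_cons, ← mul_assoc, ← sub_mul]
    exact h.anti (by omega) this
  | trans h₁ _ ih₁ ih₂ =>
    rw [← h₁.length_eq] at ih₂
    simpa using add_mem ih₁ ih₂

theorem monomial_mem (s : ι →₀ ℕ) : orderedMonomial x s ∈ F s.degree := by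
  have := h.list_prod_mem (Finsupp.toMultiset s).toList
  rwa [Multiset.length_toList, Finsupp.card_toMultiset] at this

theorem list_prod_sub_monomial_mem {s : ι →₀ ℕ} {l : List ι}
    (hl : (l : Multiset ι) = Finsupp.toMultiset s) :
    (l.map x).prod - orderedMonomial x s ∈ F (s.degree + 1) := by
  have hp : l.Perm (Finsupp.toMultiset s).toList := by
    rw [← Multiset.coe_eq_coe, hl, Multiset.coe_toList]
  have := h.list_prod_sub_mem_of_perm hp
  rwa [hp.length_eq, Multiset.length_toList, Finsupp.card_toMultiset] at this

theorem monomial_mul_sub_mem (s t : ι →₀ ℕ) :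
    orderedMonomial x s * orderedMonomial x t - orderedMonomial x (s + t) ∈
      F (s.degree + t.degree + 1) := by
  have := h.list_prod_sub_monomial_mem (s := s + t)
    (l := (Finsupp.toMultiset s).toList ++ (Finsupp.toMultiset t).toList)
    (by rw [← Multiset.coe_add]; simp)
  rw [List.map_append, List.prod_append, map_add] at this
  exact this

theorem gen_mul_monomial_sub_mem (i : ι) (s : ι →₀ ℕ) :
    x i * orderedMonomial x s - orderedMonomial x (Finsupp.single i 1 + s) ∈
      F (s.degree + 2) := by
  have := h.list_prod_sub_monomial_mem (s := Finsupp.single i 1 + s)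
    (l := i :: (Finsupp.toMultiset s).toList)
    (by rw [← Multiset.cons_coe]; simp [Finsupp.toMultiset_single])
  rw [List.map_cons, List.prod_cons, map_add, Finsupp.degree_single] at this
  exact h.anti (by omega) this

/-- Up to deeper terms the `q` factors `x i` can be moved to the front, where their product
vanishes. -/
theorem monomial_mem_succ {q : ℕ} (hq : ∀ i, x i ^ q = 0) {s : ι →₀ ℕ} {i : ι} (hi : q ≤ s i) :
    orderedMonomial x s ∈ F (s.degree + 1) := by
  have hs : Finsupp.single i q + (s - Finsupp.single i q) = s := by
    refine add_tsub_cancel_of_le ?_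
    rwa [Finsupp.single_le_iff]
  have := h.list_prod_sub_monomial_mem (s := s)
    (l := List.replicate q i ++ (Finsupp.toMultiset (s - Finsupp.single i q)).toList)
    (by rw [← Multiset.coe_add, Multiset.coe_replicate, Multiset.coe_toList]
        conv_rhs => rw [← hs, map_add, Finsupp.toMultiset_single, Multiset.nsmul_singleton])
  rw [List.map_append, List.map_replicate, List.prod_append, List.prod_replicate, hq,
    zero_mul, zero_sub] at this
  exact neg_mem_iff.1 this

/-- Induction by `F (m + 1) ≤ F 1 * F m`: a generator times a monomial is again a monomial up to
deeper terms. -/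
theorem le_span_monomial (m : ℕ) :
    F m ≤ Submodule.span k (orderedMonomial x '' {s | s.degree = m}) ⊔ F (m + 1) := by
  induction m with
  | zero =>
    refine h.zero_le.trans (sup_le_sup_right (Submodule.span_mono ?_) _)
    rintro _ rfl
    exact ⟨0, by simp, by simp [orderedMonomial]⟩
  | succ m ih =>
    refine (h.succ_le m).trans ((mul_le_mul' h.one_le ih).trans ?_)
    rw [Submodule.sup_mul, Submodule.mul_sup]
    refine sup_le (sup_le ?_ ?_) ?_
    · rw [Submodule.span_mul_span, Submodule.span_le]
      rintro _ ⟨_, ⟨i, rfl⟩, _, ⟨s, hs, rfl⟩, rfl⟩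
      have hs : s.degree = m := hs
      have h1 := h.gen_mul_monomial_sub_mem i s
      rw [hs] at h1
      have h2 : orderedMonomial x (Finsupp.single i 1 + s) ∈
          Submodule.span k (orderedMonomial x '' {s | s.degree = m + 1}) :=
        Submodule.subset_span ⟨_, by simp [hs, add_comm], rfl⟩
      simpa using Submodule.add_mem_sup h2 h1
    · refine le_sup_of_le_right (Submodule.mul_le.2 fun a ha b hb => ?_)
      have ha' : a ∈ F 1 :=
        Submodule.span_le.2 (by rintro _ ⟨i, rfl⟩; exact h.gen_mem i) ha
      exact h.anti (by omega) (h.mul_mem ha' hb)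
    · refine le_sup_of_le_right (Submodule.mul_le.2 fun a ha b hb => ?_)
      have hb' : b ∈ F m := by
        refine (sup_le (Submodule.span_le.2 ?_) (h.anti (by omega))) hb
        rintro _ ⟨s, rfl, rfl⟩
        exact h.monomial_mem s
      exact h.anti (by omega) (h.mul_mem ha hb')

/-- An element of `F m` has a leading form, unless it lies in `F (m + 1)`. -/
theorem exists_leadingForm {m : ℕ} {a : A} (ha : a ∈ F m) :
    ∃ c : (ι →₀ ℕ) →₀ k, (∀ s ∈ c.support, s.degree = m) ∧
      a - c.sum (fun s r => r • orderedMonomial x s) ∈ F (m + 1) := by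
  obtain ⟨y, hy, z, hz, rfl⟩ := Submodule.mem_sup.1 (h.le_span_monomial m ha)
  obtain ⟨c, hc, rfl⟩ := (Finsupp.mem_span_image_iff_linearCombination k).1 hy
  refine ⟨c, fun s hs => hc hs, ?_⟩
  rw [Finsupp.linearCombination_apply, add_sub_cancel_left]
  exact hz

/-- If `μ` is the leading exponent of the leading form of `a`, then the monomials whose exponents
are not divisible by `μ` span the cokernel of left multiplication by `a`. -/
theorem range_mulLeft_sup_span_eq_top (mo : MonomialOrder ι) {q N m : ℕ} (hN : F N = ⊥)
    (hq : ∀ i, x i ^ q = 0) {a : A} {c : (ι →₀ ℕ) →₀ k} (hc : ∀ s ∈ c.support, s.degree = m)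
    (ha : a - c.sum (fun s r => r • orderedMonomial x s) ∈ F (m + 1))
    {μ : ι →₀ ℕ} (hμ : μ ∈ c.support) (hmax : ∀ s ∈ c.support, mo.toSyn s ≤ mo.toSyn μ) :
    LinearMap.range (LinearMap.mulLeft k a) ⊔
      Submodule.span k (orderedMonomial x '' {s | (∀ i, s i < q) ∧ ¬ μ ≤ s}) = ⊤ := by
  set W := LinearMap.range (LinearMap.mulLeft k a) ⊔
      Submodule.span k (orderedMonomial x '' {s | (∀ i, s i < q) ∧ ¬ μ ≤ s}) with hW
  -- Descending induction on depth, starting from `F N = ⊥`. Within one depth, a second induction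
  -- follows the monomial order.
  suffices H : ∀ r, r ≤ N → F (N - r) ≤ W by
    have := H N le_rfl
    rwa [Nat.sub_self, h.zero_eq_top, top_le_iff] at this
  classical
  intro r
  induction r with
  | zero => intro _; simp [hN]
  | succ r ih =>
    intro hr
    specialize ih (by omega)
    obtain ⟨e, he⟩ : ∃ e, N - (r + 1) = e := ⟨_, rfl⟩
    rw [show N - r = e + 1 by omega] at ih
    rw [he]
    refine (h.le_span_monomial e).trans (sup_le (Submodule.span_le.2 ?_) ih)
    rintro _ ⟨s, hs, rfl⟩
    have key : ∀ (b : mo.syn) (s : ι →₀ ℕ), mo.toSyn s = b → s.degree = e →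
        orderedMonomial x s ∈ W := by
      intro b
      induction b using WellFoundedLT.induction with
      | ind b IH =>
        intro s hsb hse
        by_cases h1 : ∃ i, q ≤ s i
        · obtain ⟨i, hi⟩ := h1
          exact ih (hse ▸ h.monomial_mem_succ hq hi)
        push Not at h1
        by_cases h2 : μ ≤ s
        swap
        · exact Submodule.mem_sup_right (Submodule.subset_span ⟨s, ⟨h1, h2⟩, rfl⟩)
        -- Now `s = μ + t`. Modulo depth `e + 1`, already inside `W`, the product of `a` and the
        -- monomial of `t` is the sum of the terms `c s • orderedMonomial x (s + t)`. Those with `s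
        -- ≠ μ` are smaller in the monomial order, hence in `W`; so the remaining one, with nonzero
        -- coefficient `c μ`, is in `W` too.
        obtain ⟨t, rfl⟩ := exists_add_of_le h2
        have hμm := hc μ hμ
        have hd : m + t.degree = e := by rw [← hse, map_add, hμm]
        have hmul : a * orderedMonomial x t ∈ W :=
          Submodule.mem_sup_left ⟨orderedMonomial x t, rfl⟩
        have h3 : a * orderedMonomial x t -
            c.sum (fun s r => r • (orderedMonomial x s * orderedMonomial x t)) ∈ W := by
          have := h.mul_mem ha (h.monomial_mem t)
          rw [sub_mul, Finsupp.sum_mul] at this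
          simp only [smul_mul_assoc] at this
          exact ih (h.anti (by omega) this)
        have h4 : c.sum (fun s r => r • (orderedMonomial x s * orderedMonomial x t)) -
            c.sum (fun s r => r • orderedMonomial x (s + t)) ∈ W := by
          rw [Finsupp.sum, Finsupp.sum, ← Finset.sum_sub_distrib]
          refine sum_mem fun s hs => ?_
          rw [← smul_sub]
          refine W.smul_mem _ (ih (h.anti ?_ (h.monomial_mul_sub_mem s t)))
          rw [hc s hs]; omega
        have h5 : c.sum (fun s r => r • orderedMonomial x (s + t)) ∈ W := by
          have := sub_mem (sub_mem hmul h3) h4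
          simpa using this
        classical
    rw [Finsupp.sum, ← Finset.add_sum_erase _ _ hμ] at h5
        have h6 : ∑ s ∈ c.support.erase μ, c s • orderedMonomial x (s + t) ∈ W := by
          refine sum_mem fun s hs => W.smul_mem _ ?_
          obtain ⟨hne, hs⟩ := Finset.mem_erase.1 hs
          refine IH (mo.toSyn (s + t)) ?_ (s + t) rfl (by rw [map_add, hc s hs, hd])
          rw [← hsb, map_add, map_add]
          refine add_lt_add_left (lt_of_le_of_ne (hmax s hs) fun hh => hne ?_) _
          exact mo.toSyn.injective hh
        have h7 := (Submodule.add_mem_iff_left _ h6).1 h5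
        exact (W.smul_mem_iff (Finsupp.mem_support_iff.1 hμ)).1 h7
    exact key _ s rfl hs

end AlmostCommFiltration

/-- If `μ ≤ s` fails then `s i < μ i` for some `i`; for each `i` this leaves at most `μ i` values in
one coordinate and `q` in each of the others. -/
theorem card_bounded_not_ge_le [Fintype ι] (q : ℕ) (μ : ι →₀ ℕ) :
    ({s : ι →₀ ℕ | (∀ i, s i < q) ∧ ¬ μ ≤ s}).Finite ∧
    ({s : ι →₀ ℕ | (∀ i, s i < q) ∧ ¬ μ ≤ s}).ncard ≤
      μ.degree * q ^ (Fintype.card ι - 1) := by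
  classical
  set T : Finset (ι → ℕ) := Finset.univ.biUnion fun i =>
    Fintype.piFinset (Function.update (fun _ => Finset.range q) i (Finset.range (μ i)))
  have hT : T.card ≤ μ.degree * q ^ (Fintype.card ι - 1) := by
    refine Finset.card_biUnion_le.trans ?_
    rw [Finsupp.degree_eq_sum, Finset.sum_mul]
    refine Finset.sum_le_sum fun i _ => ?_
    rw [Fintype.card_piFinset, ← Finset.mul_prod_erase _ _ (Finset.mem_univ i)]
    rw [Function.update_self, Finset.card_range, Finset.prod_congr rfl
      (g := fun _ => q), Finset.prod_const, Finset.card_erase_of_mem (Finset.mem_univ i),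
      Finset.card_univ]
    intro j hj
    rw [Function.update_of_ne (Finset.ne_of_mem_erase hj), Finset.card_range]
  have hsub : {s : ι →₀ ℕ | (∀ i, s i < q) ∧ ¬ μ ≤ s} ⊆
      (fun s : ι →₀ ℕ => (s : ι → ℕ)) ⁻¹' (T : Set (ι → ℕ)) := by
    rintro s ⟨h1, h2⟩
    obtain ⟨i, hi⟩ : ∃ i, s i < μ i := by
      by_contra! H
      exact h2 H
    simp only [T, Set.mem_preimage, Finset.mem_coe, Finset.mem_biUnion, Finset.mem_univ, true_and]
    refine ⟨i, Fintype.mem_piFinset.2 fun j => ?_⟩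
    by_cases hj : j = i
    · subst hj; simpa using hi
    · simpa [hj] using h1 j
  have hinj : Function.Injective (fun s : ι →₀ ℕ => (s : ι → ℕ)) := DFunLike.coe_injective
  have hfin := (T.finite_toSet.preimage hinj.injOn)
  refine ⟨hfin.subset hsub, (Set.ncard_le_ncard hsub hfin).trans (le_trans ?_ hT)⟩
  rw [← Set.ncard_coe_finset T]
  exact Set.ncard_le_ncard_of_injOn _ (fun a ha => ha) hinj.injOn T.finite_toSet

theorem AlmostCommFiltration.finrank_ker_mulLeft_le [Fintype ι] [FiniteDimensional k A]
    {F : ℕ → Submodule k A} {x : ι → A} (h : AlmostCommFiltration F x)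
    (mo : MonomialOrder ι) {q N m : ℕ} (hN : F N = ⊥)
    (hq : ∀ i, x i ^ q = 0) {a : A} {c : (ι →₀ ℕ) →₀ k} (hc : ∀ s ∈ c.support, s.degree = m)
    (ha : a - c.sum (fun s r => r • orderedMonomial x s) ∈ F (m + 1)) (hc0 : c ≠ 0) :
    Module.finrank k (LinearMap.ker (LinearMap.mulLeft k a)) ≤
      m * q ^ (Fintype.card ι - 1) := by
  classical
  obtain ⟨μ, hμ, hmax⟩ := c.support.exists_max_image mo.toSyn (Finsupp.support_nonempty_iff.2 hc0)
  have htop := h.range_mulLeft_sup_span_eq_top mo hN hq hc ha hμ hmax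
  obtain ⟨hfin, hcard⟩ := card_bounded_not_ge_le q μ
  rw [hc μ hμ] at hcard
  refine le_trans ?_ hcard
  set S := {s : ι →₀ ℕ | (∀ i, s i < q) ∧ ¬ μ ≤ s}
  have h1 := LinearMap.finrank_range_add_finrank_ker (LinearMap.mulLeft k a)
  have h2 : Module.finrank k (Submodule.span k (orderedMonomial x '' S)) ≤ S.ncard := by
    have := (hfin.image (orderedMonomial x)).fintype
    refine (finrank_span_le_card _).trans ?_
    rw [← Set.ncard_eq_toFinset_card']
    exact Set.ncard_image_le hfin
  have h3 := Submodule.finrank_add_le_finrank_add_finrank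
    (LinearMap.range (LinearMap.mulLeft k a)) (Submodule.span k (orderedMonomial x '' S))
  rw [htop, finrank_top] at h3
  omega

end Filtration

/-! ### The augmentation filtration of a group algebra -/

section GroupAlgebra

open MonoidAlgebra (of)

/-- Moving every group element to a chosen representative of its fibre changes `a` by differences
lying in `V`, and the moved element depends only on the image of `a`, which is zero. -/
theorem MonoidAlgebra.mem_of_mapDomain_eq_zero {k G H : Type*} [Field k] [Nonempty G] {f : G → H}
    {V : AddSubmonoid (MonoidAlgebra k G)}
    (hV : ∀ g g' r, f g = f g' → single g r - single g' r ∈ V) {a : MonoidAlgebra k G}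
    (ha : mapDomain f a = 0) : a ∈ V := by
  have key : ∀ a : MonoidAlgebra k G, a - mapDomain (Function.invFun f) (mapDomain f a) ∈ V := by
    intro a
    induction a using MonoidAlgebra.induction_linear with
    | zero => simp
    | add x y hx hy =>
      rw [mapDomain_add, mapDomain_add, add_sub_add_comm]
      exact add_mem hx hy
    | single g r =>
      rw [mapDomain_single, mapDomain_single]
      exact hV _ _ _ (Function.invFun_eq ⟨g, rfl⟩).symm
  simpa [ha] using key a

theorem MonoidAlgebra.of_sub_one_pow_char (k : Type*) {G : Type*} [Field k] [Group G] (p : ℕ)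
    [Fact p.Prime] [CharP k p] (g : G) (n : ℕ) :
    (of k G g - 1) ^ p ^ n = of k G (g ^ p ^ n) - 1 := by
  have : CharP (MonoidAlgebra k G) p :=
    charP_of_injective_algebraMap (algebraMap k (MonoidAlgebra k G)).injective p
  rw [sub_pow_char_pow_of_commute _ _ (Commute.one_right _), one_pow, map_pow]

variable (k G : Type*) {H : Type*} [Field k] [Group G] [Group H]

/-- The span of the elements `g - 1` of the group algebra. -/
noncomputable def augSpan : Submodule k (MonoidAlgebra k G) :=
  Submodule.span k (Set.range fun g => of k G g - 1)

/-- The filtration of a group algebra by the powers of its augmentation ideal. -/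
noncomputable def augFiltration (m : ℕ) : Submodule k (MonoidAlgebra k G) := augSpan k G ^ m * ⊤

variable {k G}

theorem of_sub_one_mem_augSpan (g : G) : of k G g - 1 ∈ augSpan k G :=
  Submodule.subset_span ⟨g, rfl⟩

theorem top_eq_span_of : (⊤ : Submodule k (MonoidAlgebra k G)) =
    Submodule.span k (Set.range (of k G)) := by
  refine (top_le_iff.1 fun a _ => ?_).symm
  induction a using MonoidAlgebra.induction_linear with
  | zero => simp
  | add x y hx hy => exact add_mem (hx trivial) (hy trivial)
  | single g r =>
    rw [show MonoidAlgebra.single g r = r • of k G g by simp]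
    exact Submodule.smul_mem _ _ (Submodule.subset_span ⟨g, rfl⟩)

theorem top_mul_augSpan_le : (⊤ : Submodule k (MonoidAlgebra k G)) * augSpan k G ≤ augSpan k G := by
  rw [top_eq_span_of, augSpan, Submodule.span_mul_span, Submodule.span_le]
  rintro _ ⟨_, ⟨g, rfl⟩, _, ⟨h, rfl⟩, rfl⟩
  have : of k G g * (of k G h - 1) = (of k G (g * h) - 1) - (of k G g - 1) := by
    rw [map_mul]; noncomm_ring
  change of k G g * (of k G h - 1) ∈ _
  rw [this]
  exact sub_mem (of_sub_one_mem_augSpan _) (of_sub_one_mem_augSpan _)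

theorem augSpan_mul_top : augSpan k G * (⊤ : Submodule k (MonoidAlgebra k G)) = augSpan k G := by
  refine le_antisymm ?_ fun a ha => ?_
  · rw [top_eq_span_of, augSpan, Submodule.span_mul_span, Submodule.span_le]
    rintro _ ⟨_, ⟨g, rfl⟩, _, ⟨h, rfl⟩, rfl⟩
    have : (of k G g - 1) * of k G h = (of k G (g * h) - 1) - (of k G h - 1) := by
      rw [map_mul]; noncomm_ring
    change (of k G g - 1) * of k G h ∈ _
    rw [this]
    exact sub_mem (of_sub_one_mem_augSpan _) (of_sub_one_mem_augSpan _)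
  · simpa using Submodule.mul_mem_mul ha (Submodule.mem_top (x := (1 : MonoidAlgebra k G)))

/-- Only here does the factor `⊤` in `augFiltration` matter: `augSpan k G ^ 0` is just the span of
`1`, while in positive degrees `augSpan_mul_top` absorbs the factor. -/
theorem augFiltration_zero : augFiltration k G 0 = ⊤ := by
  rw [augFiltration, pow_zero, one_mul]

theorem augFiltration_one : augFiltration k G 1 = augSpan k G := by
  rw [augFiltration, pow_one, augSpan_mul_top]

theorem of_sub_one_mem (g : G) : of k G g - 1 ∈ augFiltration k G 1 :=
  augFiltration_one (k := k) (G := G) ▸ of_sub_one_mem_augSpan g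

theorem augFiltration_add_le (i j : ℕ) :
    augFiltration k G (i + j) ≤ augFiltration k G i * augFiltration k G j := by
  rw [augFiltration, pow_add, mul_assoc]
  refine mul_le_mul' (fun a ha => ?_) le_rfl
  simpa [augFiltration] using
    Submodule.mul_mem_mul ha (Submodule.mem_top (x := (1 : MonoidAlgebra k G)))

theorem augFiltration_mul_le (i j : ℕ) :
    augFiltration k G i * augFiltration k G j ≤ augFiltration k G (i + j) := by
  have key : (⊤ : Submodule k (MonoidAlgebra k G)) * augSpan k G ^ j ≤ augSpan k G ^ j * ⊤ := by
    cases j with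
    | zero => simp
    | succ j =>
      rw [pow_succ', ← mul_assoc]
      refine (mul_le_mul' top_mul_augSpan_le le_rfl).trans fun a ha => ?_
      simpa using Submodule.mul_mem_mul ha (Submodule.mem_top (x := (1 : MonoidAlgebra k G)))
  calc augSpan k G ^ i * ⊤ * (augSpan k G ^ j * ⊤)
      = augSpan k G ^ i * (⊤ * augSpan k G ^ j) * ⊤ := by simp only [mul_assoc]
    _ ≤ augSpan k G ^ i * (augSpan k G ^ j * ⊤) * ⊤ := by gcongr
    _ = augSpan k G ^ (i + j) * (⊤ * ⊤) := by rw [pow_add]; simp only [mul_assoc]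
    _ ≤ augSpan k G ^ (i + j) * ⊤ := by gcongr; exact le_top

theorem augFiltration_mul_mem {i j : ℕ} {a b : MonoidAlgebra k G} (ha : a ∈ augFiltration k G i)
    (hb : b ∈ augFiltration k G j) : a * b ∈ augFiltration k G (i + j) :=
  augFiltration_mul_le i j (Submodule.mul_mem_mul ha hb)

theorem augFiltration_pow_mem {i : ℕ} {a : MonoidAlgebra k G} (ha : a ∈ augFiltration k G i)
    (n : ℕ) : a ^ n ∈ augFiltration k G (i * n) := by
  induction n with
  | zero => simp [augFiltration_zero]
  | succ n ih => rw [pow_succ, mul_add_one]; exact augFiltration_mul_mem ih ha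

theorem augFiltration_antitone : Antitone (augFiltration k G) := by
  refine antitone_nat_of_succ_le fun m => ?_
  rw [augFiltration, pow_succ, mul_assoc]
  exact mul_le_mul' le_rfl le_top

theorem augFiltration_map {f : G →* H} (hf : Function.Surjective f) (m : ℕ) :
    (augFiltration k G m).map (MonoidAlgebra.mapDomainAlgHom k k f).toLinearMap =
      augFiltration k H m := by
  have hI : (augSpan k G).map (MonoidAlgebra.mapDomainAlgHom k k f).toLinearMap = augSpan k H := by
    rw [augSpan, augSpan, Submodule.map_span, ← Set.range_comp]
    congr 1
    ext a
    have hg : ∀ g, MonoidAlgebra.mapDomainAlgHom k k f (of k G g - 1) = of k H (f g) - 1 :=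
      fun g => by rw [map_sub, map_one]; simp
    constructor
    · rintro ⟨g, rfl⟩; exact ⟨f g, (hg g).symm⟩
    · rintro ⟨h, rfl⟩
      obtain ⟨g, rfl⟩ := hf h
      exact ⟨g, hg g⟩
  have hT : (⊤ : Submodule k (MonoidAlgebra k G)).map
      (MonoidAlgebra.mapDomainAlgHom k k f).toLinearMap = ⊤ := by
    rw [top_eq_span_of, top_eq_span_of, Submodule.map_span, ← Set.range_comp]
    congr 1
    ext a
    constructor
    · rintro ⟨g, rfl⟩; exact ⟨f g, by simp⟩
    · rintro ⟨h, rfl⟩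
      obtain ⟨g, rfl⟩ := hf h
      exact ⟨g, by simp⟩
  rw [augFiltration, Submodule.map_mul, Submodule.map_pow, hI, hT, augFiltration]

/-- The elements `g` with `g - 1` in a given subspace that absorbs the augmentation ideal. -/
noncomputable def oneAddSubgroup (V : Submodule k (MonoidAlgebra k G))
    (hV : ∀ a ∈ V, ∀ b ∈ augFiltration k G 1, a * b ∈ V) : Subgroup G where
  carrier := {g | of k G g - 1 ∈ V}
  one_mem' := by
    change of k G 1 - 1 ∈ V
    rw [map_one, sub_self]
    exact V.zero_mem
  mul_mem' {g h} hg hh := by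
    have : of k G (g * h) - 1 =
        (of k G g - 1) * (of k G h - 1) + (of k G g - 1) + (of k G h - 1) := by
      rw [map_mul]; noncomm_ring
    change of k G _ - 1 ∈ V
    rw [this]
    exact add_mem (add_mem (hV _ hg _ (of_sub_one_mem h)) hg) hh
  inv_mem' {g} hg := by
    have h1 : of k G g * of k G g⁻¹ = 1 := by rw [← map_mul, mul_inv_cancel, map_one]
    have : of k G g⁻¹ - 1 = -((of k G g - 1) * (of k G g⁻¹ - 1) + (of k G g - 1)) := by
      rw [sub_mul, mul_sub, h1]; noncomm_ring
    change of k G _ - 1 ∈ V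
    rw [this]
    exact neg_mem (add_mem (hV _ hg _ (of_sub_one_mem _)) hg)

theorem mem_oneAddSubgroup {V : Submodule k (MonoidAlgebra k G)}
    {hV : ∀ a ∈ V, ∀ b ∈ augFiltration k G 1, a * b ∈ V} {g : G} :
    g ∈ oneAddSubgroup V hV ↔ of k G g - 1 ∈ V := Iff.rfl

/-- The dimension subgroups of `G` over `k`. -/
noncomputable def dimensionSubgroup (k G : Type*) [Field k] [Group G] (m : ℕ) : Subgroup G :=
  oneAddSubgroup (augFiltration k G m) fun _ ha _ hb =>
    augFiltration_antitone (Nat.le_add_right m 1) (augFiltration_mul_mem ha hb)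

theorem mem_dimensionSubgroup {g : G} {m : ℕ} :
    g ∈ dimensionSubgroup k G m ↔ of k G g - 1 ∈ augFiltration k G m := Iff.rfl

/-- The kernel is generated by differences `g - g' = (g * g'⁻¹ - 1) * g'` with `g * g'⁻¹` in
`f.ker`. -/
theorem ker_mapDomain_le_augFiltration {f : G →* H} {m : ℕ}
    (hf : f.ker ≤ dimensionSubgroup k G m) {a : MonoidAlgebra k G}
    (ha : MonoidAlgebra.mapDomain f a = 0) : a ∈ augFiltration k G m := by
  refine MonoidAlgebra.mem_of_mapDomain_eq_zero (V := (augFiltration k G m).toAddSubmonoid)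
    (fun g g' r h => ?_) ha
  have h1 : g * g'⁻¹ ∈ dimensionSubgroup k G m := hf (by simp [MonoidHom.mem_ker, h])
  have h2 := augFiltration_mul_mem (mem_dimensionSubgroup.1 h1)
    (b := MonoidAlgebra.single g' r) (j := 0) (by simp [augFiltration_zero])
  have : MonoidAlgebra.single g r - MonoidAlgebra.single g' r =
      (of k G (g * g'⁻¹) - 1) * MonoidAlgebra.single g' r := by
    simp [sub_mul, MonoidAlgebra.single_mul_single]
  rw [this]
  exact h2

variable (k) in
/-- The augmentation ideal of a finite `p`-group in characteristic `p` is nilpotent. -/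
theorem exists_augFiltration_eq_bot (p : ℕ) [Fact p.Prime] [CharP k p] [Finite G]
    (hG : IsPGroup p G) : ∃ N, augFiltration k G N = ⊥ := by
  induction hn : Nat.card G using Nat.strong_induction_on generalizing G with
  | _ n IH =>
    rcases subsingleton_or_nontrivial G with hs | hs
    · refine ⟨1, ?_⟩
      rw [augFiltration_one, augSpan, Submodule.span_eq_bot]
      rintro _ ⟨g, rfl⟩
      simp only [Subsingleton.elim g 1, map_one, sub_self]
    -- Take `z` central of order `p` and `y = z - 1`. By induction some power `N` of the
    -- augmentation ideal dies modulo `z`, so it lies in the ideal generated by the central element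
    -- `y`; then the power `N * p` lies in the ideal generated by `y ^ p = z ^ p - 1 = 0`.
    have hc := hG.center_nontrivial
    have hdvd : p ∣ Nat.card (Subgroup.center G) :=
      (hG.to_subgroup _).card_eq_or_dvd.resolve_left
        (by have := Finite.one_lt_card (α := Subgroup.center G); omega)
    obtain ⟨⟨z, hz⟩, hzo⟩ := exists_prime_orderOf_dvd_card' p hdvd
    have hzo : orderOf z = p := by rwa [Subgroup.orderOf_mk] at hzo
    have hzc : ∀ g, g * z = z * g := Subgroup.mem_center_iff.1 hz
    have hnorm : (Subgroup.zpowers z).Normal := by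
      refine ⟨fun n hn g => ?_⟩
      obtain ⟨i, rfl⟩ := Subgroup.mem_zpowers_iff.1 hn
      have : Commute g (z ^ i) := (show Commute g z from hzc g).zpow_right i
      rw [this.eq, mul_inv_cancel_right]
      exact hn
    obtain ⟨N, hN⟩ := IH (Nat.card (G ⧸ Subgroup.zpowers z)) (by
      rw [← hn, Subgroup.card_eq_card_quotient_mul_card_subgroup (Subgroup.zpowers z),
        Nat.card_zpowers, hzo]
      exact lt_mul_of_one_lt_right Nat.card_pos (Fact.out : p.Prime).one_lt)
      (hG.to_quotient _) rfl
    set y := of k G z - 1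
    have hyc : ∀ a, a * y = y * a := by
      intro a
      induction a using MonoidAlgebra.induction_linear with
      | zero => simp
      | add a b ha hb => rw [add_mul, mul_add, ha, hb]
      | single g r => simp [y, mul_sub, sub_mul, MonoidAlgebra.single_mul_single, hzc]
    have h1 : augFiltration k G N ≤ LinearMap.range (LinearMap.mulLeft k y) := by
      intro a ha
      have h0 : MonoidAlgebra.mapDomain (QuotientGroup.mk' (Subgroup.zpowers z)) a = 0 := by
        have := Submodule.mem_map_of_mem
          (f := (MonoidAlgebra.mapDomainAlgHom k k
            (QuotientGroup.mk' (Subgroup.zpowers z))).toLinearMap) ha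
        rw [augFiltration_map (QuotientGroup.mk'_surjective _), hN] at this
        simpa using this
      refine MonoidAlgebra.mem_of_mapDomain_eq_zero
        (V := (LinearMap.range (LinearMap.mulLeft k y)).toAddSubmonoid) (fun g g' r h => ?_) h0
      have h2 : g'⁻¹ * g ∈ Subgroup.zpowers z := by
        rw [← QuotientGroup.eq]; exact h.symm
      rw [← mem_powers_iff_mem_zpowers] at h2
      obtain ⟨i, hi⟩ := h2
      have hi : z ^ i = g'⁻¹ * g := hi
      have hg : g = z ^ i * g' := by
        rw [((show Commute z g' from (hzc g').symm).pow_left i).eq, hi, mul_inv_cancel_left]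
      refine ⟨(∑ j ∈ Finset.range i, of k G z ^ j) * MonoidAlgebra.single g' r, ?_⟩
      rw [LinearMap.mulLeft_apply, ← mul_assoc, mul_geom_sum, ← map_pow, sub_mul, one_mul, hg]
      simp [MonoidAlgebra.single_mul_single]
    have h2 : ∀ r, augFiltration k G (N * r) ≤ LinearMap.range (LinearMap.mulLeft k (y ^ r)) := by
      intro r
      induction r with
      | zero => intro a _; exact ⟨a, by simp⟩
      | succ r ih =>
        rw [mul_add_one, add_comm]
        refine (augFiltration_add_le _ _).trans (Submodule.mul_le.2 fun a ha b hb => ?_)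
        obtain ⟨a, rfl⟩ := h1 ha
        obtain ⟨b, rfl⟩ := ih hb
        refine ⟨a * b, ?_⟩
        simp only [LinearMap.mulLeft_apply]
        rw [pow_succ', mul_assoc, mul_assoc, ← mul_assoc a,
          (show Commute a (y ^ r) from (show Commute a y from hyc a).pow_right r).eq, mul_assoc]
    refine ⟨N * p, le_bot_iff.1 ((h2 p).trans ?_)⟩
    have hy : y ^ p = 0 := by
      have := MonoidAlgebra.of_sub_one_pow_char k p z 1
      rwa [pow_one, ← hzo, pow_orderOf_eq_one, map_one, sub_self, hzo] at this
    rintro _ ⟨a, rfl⟩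
    simp [hy]

/-- The additive commutator equals `g * h - h * g = (g * h * g⁻¹ * h⁻¹ - 1) * (h * g)`. -/
theorem of_sub_one_commutator_mem {m : ℕ} {g h : G}
    (hgh : g * h * g⁻¹ * h⁻¹ ∈ dimensionSubgroup k G m) :
    (of k G g - 1) * (of k G h - 1) - (of k G h - 1) * (of k G g - 1) ∈ augFiltration k G m := by
  have h1 := augFiltration_mul_mem (mem_dimensionSubgroup.1 hgh)
    (b := of k G (h * g)) (j := 0) (by rw [augFiltration_zero]; trivial)
  have h2 : of k G (g * h * g⁻¹ * h⁻¹) * of k G (h * g) = of k G g * of k G h := by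
    rw [← map_mul, ← map_mul]; congr 1; group
  have : (of k G g - 1) * (of k G h - 1) - (of k G h - 1) * (of k G g - 1) =
      (of k G (g * h * g⁻¹ * h⁻¹) - 1) * of k G (h * g) := by
    rw [sub_mul _ _ (of k G (h * g)), h2, map_mul, one_mul]
    noncomm_ring
  rw [this]
  exact h1

theorem augFiltration_zero_le :
    augFiltration k G 0 ≤ Submodule.span k {1} ⊔ augFiltration k G 1 := by
  rw [augFiltration_zero, top_eq_span_of, Submodule.span_le]
  rintro _ ⟨g, rfl⟩
  have := Submodule.add_mem_sup (Submodule.mem_span_singleton_self (R := k)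
    (1 : MonoidAlgebra k G)) (of_sub_one_mem (k := k) g)
  rwa [add_sub_cancel] at this

/-- Turns group generation modulo the second dimension subgroup into linear spanning: the `g` with
`g - 1` in `V` form a subgroup, because products of two elements of depth one fall into depth 2. -/
theorem augFiltration_one_le {ι : Type*} {g : ι → G}
    (hgen : ∀ V : Subgroup G, dimensionSubgroup k G 2 ≤ V → (∀ i, g i ∈ V) → V = ⊤) :
    augFiltration k G 1 ≤
      Submodule.span k (Set.range fun i => of k G (g i) - 1) ⊔ augFiltration k G 2 := by
  set V := Submodule.span k (Set.range fun i => of k G (g i) - 1) ⊔ augFiltration k G 2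
  have hV1 : V ≤ augFiltration k G 1 := by
    refine sup_le (Submodule.span_le.2 ?_) (augFiltration_antitone one_le_two)
    rintro _ ⟨i, rfl⟩
    exact of_sub_one_mem _
  have hV : ∀ a ∈ V, ∀ b ∈ augFiltration k G 1, a * b ∈ V := fun a ha b hb =>
    Submodule.mem_sup_right (augFiltration_antitone (le_refl 2)
      (augFiltration_mul_mem (i := 1) (j := 1) (hV1 ha) hb))
  have htop := hgen (oneAddSubgroup V hV)
    (fun g hg => mem_oneAddSubgroup.2 (Submodule.mem_sup_right (mem_dimensionSubgroup.1 hg)))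
    (fun i => mem_oneAddSubgroup.2 (Submodule.mem_sup_left (Submodule.subset_span ⟨i, rfl⟩)))
  rw [augFiltration_one, augSpan, Submodule.span_le]
  rintro _ ⟨g, rfl⟩
  have hg : g ∈ oneAddSubgroup V hV := by rw [htop]; exact Subgroup.mem_top g
  exact mem_oneAddSubgroup.1 hg

/-- A criterion for the augmentation filtration to be almost commutative. -/
theorem augFiltration_almostComm {ι : Type*} {g : ι → G}
    (hcomm : ∀ i j, g i * g j * (g i)⁻¹ * (g j)⁻¹ ∈ dimensionSubgroup k G 3)
    (hgen : ∀ V : Subgroup G, dimensionSubgroup k G 2 ≤ V → (∀ i, g i ∈ V) → V = ⊤) :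
    AlmostCommFiltration (augFiltration k G) (fun i => of k G (g i) - 1) :=
  ⟨augFiltration_zero, augFiltration_antitone, augFiltration_mul_mem, fun _ => of_sub_one_mem _,
    fun i j => of_sub_one_commutator_mem (hcomm i j), augFiltration_zero_le,
    augFiltration_one_le hgen, fun m => by rw [add_comm]; exact augFiltration_add_le 1 m⟩

end GroupAlgebra

/-! ### Powers, commutators and generators in the congruence subgroups -/

section Congruence

variable {u d p : ℕ} [Fact p.Prime]

theorem one_add_pow_eq_add_cube {R : Type*} [Ring R] (x : R) (n : ℕ) :
    ∃ r, (1 + x) ^ n = 1 + n • x + n.choose 2 • x ^ 2 + x ^ 3 * r := by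
  induction n with
  | zero => exact ⟨0, by simp⟩
  | succ n ih =>
    obtain ⟨r, hr⟩ := ih
    refine ⟨n.choose 2 • 1 + r + x * r, ?_⟩
    rw [pow_succ', hr, Nat.choose_succ_succ' n 1, Nat.choose_one_right]
    simp only [nsmul_eq_mul, Nat.cast_add, Nat.cast_one, mul_add, add_mul, mul_one, one_mul]
    rw [← mul_assoc x (n : R) x, ← Nat.cast_comm n x, ← mul_assoc x (n.choose 2 : R) (x ^ 2),
      ← Nat.cast_comm (n.choose 2) x, ← Nat.cast_comm (n.choose 2) (x ^ 3)]
    simp only [pow_succ, pow_zero, one_mul, mul_assoc]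
    abel

theorem mem_CS_iff_exists {i : ℕ} {A : GL (Fin d) ℤ_[p]} :
    A ∈ CS i d p ↔ ∃ B, A.1 = 1 + (p : ℤ_[p]) ^ i • B := by
  rw [mem_CS_iff]
  constructor
  · intro h
    choose B hB using h
    refine ⟨Matrix.of B, ?_⟩
    ext r c
    rw [Matrix.add_apply, Matrix.smul_apply, Matrix.of_apply, smul_eq_mul, ← hB]
    ring
  · rintro ⟨B, hB⟩ r c
    exact ⟨B r c, by rw [hB, Matrix.add_apply, Matrix.smul_apply, smul_eq_mul]; ring⟩

theorem inv_mul_mem_CS_iff {i : ℕ} {A B : GL (Fin d) ℤ_[p]} :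
    A⁻¹ * B ∈ CS i d p ↔ ∃ C, B.1 = A.1 + (p : ℤ_[p]) ^ i • C := by
  rw [mem_CS_iff_exists]
  constructor
  · rintro ⟨C, hC⟩
    refine ⟨A.1 * C, ?_⟩
    have : A.1 * (A⁻¹ * B).1 = B.1 := by
      rw [← Units.val_mul, mul_inv_cancel_left]
    rw [← this, hC, mul_add, mul_one, mul_smul_comm]
  · rintro ⟨C, hC⟩
    refine ⟨(A⁻¹).1 * C, ?_⟩
    rw [Units.val_mul, hC, mul_add, mul_smul_comm, Units.inv_mul]

theorem exists_mem_CS {i : ℕ} (hi : 0 < i) (B : Matrix (Fin d) (Fin d) ℤ_[p]) :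
    ∃ A ∈ CS i d p, A.1 = 1 + (p : ℤ_[p]) ^ i • B :=
  exists_mem_CS_of_congr hi _ fun r c =>
    ⟨B r c, by rw [Matrix.add_apply, Matrix.smul_apply, smul_eq_mul]; ring⟩

/-- The quadratic term is divisible by `p ^ (2 * v + 1)` for odd `p`, and by `p ^ (2 * v)` with `v ≥
2` for `p = 2`; the cubic remainder is divisible by `p ^ (3 * v)`. All these exponents are at least
`v + 2`. -/
theorem exists_one_add_smul_pow_prime {v : ℕ} (hv : 1 ≤ v) (hp : p = 2 → 2 ≤ v)
    (B : Matrix (Fin d) (Fin d) ℤ_[p]) :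
    ∃ C, (1 + (p : ℤ_[p]) ^ v • B) ^ p =
      1 + (p : ℤ_[p]) ^ (v + 1) • B + (p : ℤ_[p]) ^ (v + 2) • C := by
  obtain ⟨R, hR⟩ := one_add_pow_eq_add_cube ((p : ℤ_[p]) ^ v • B) p
  have h2 : ∃ C, p.choose 2 • ((p : ℤ_[p]) ^ v • B) ^ 2 = (p : ℤ_[p]) ^ (v + 2) • C := by
    rw [smul_pow, ← pow_mul]
    by_cases h : p = 2
    · obtain ⟨w, rfl⟩ := Nat.exists_eq_add_of_le (hp h)
      refine ⟨p.choose 2 • (p : ℤ_[p]) ^ w • B ^ 2, ?_⟩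
      rw [smul_comm _ (p.choose 2), smul_smul, ← pow_add]
      congr 3
      ring
    · have hp2 := (Fact.out : p.Prime).two_le
      obtain ⟨t, ht⟩ := (Fact.out : p.Prime).dvd_choose_self two_ne_zero (by omega)
      obtain ⟨w, rfl⟩ := Nat.exists_eq_add_of_le hv
      refine ⟨t • (p : ℤ_[p]) ^ w • B ^ 2, ?_⟩
      rw [ht, ← Nat.cast_smul_eq_nsmul ℤ_[p] (p * t), ← Nat.cast_smul_eq_nsmul ℤ_[p] t]
      simp only [smul_smul]
      congr 1
      push_cast
      ring
  have h3 : ∃ C, ((p : ℤ_[p]) ^ v • B) ^ 3 * R = (p : ℤ_[p]) ^ (v + 2) • C := by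
    obtain ⟨w, rfl⟩ := Nat.exists_eq_add_of_le hv
    refine ⟨(p : ℤ_[p]) ^ (2 * w) • (B ^ 3 * R), ?_⟩
    rw [smul_pow, smul_mul_assoc, smul_smul]
    congr 1
    ring
  obtain ⟨C2, hC2⟩ := h2
  obtain ⟨C3, hC3⟩ := h3
  refine ⟨C2 + C3, ?_⟩
  rw [hR, hC2, hC3, ← Nat.cast_smul_eq_nsmul ℤ_[p] p, smul_smul, ← pow_succ', smul_add, add_assoc]

theorem pow_mem_CS {v : ℕ} (hv : 1 ≤ v) (hp : p = 2 → 2 ≤ v) {A : GL (Fin d) ℤ_[p]}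
    (hA : A ∈ CS v d p) : A ^ p ∈ CS (v + 1) d p := by
  obtain ⟨B, hB⟩ := mem_CS_iff_exists.1 hA
  obtain ⟨C, hC⟩ := exists_one_add_smul_pow_prime hv hp B
  refine mem_CS_iff_exists.2 ⟨B + (p : ℤ_[p]) • C, ?_⟩
  rw [Units.val_pow_eq_pow_val, hB, hC, smul_add, smul_smul, ← pow_succ, add_assoc]

/-- For `A = 1 + p ^ (v + 1) X` the approximate `p`-th root is `B = 1 + p ^ v X`. -/
theorem exists_pow_inv_mul_mem_CS {v : ℕ} (hv : 1 ≤ v) (hp : p = 2 → 2 ≤ v)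
    {A : GL (Fin d) ℤ_[p]} (hA : A ∈ CS (v + 1) d p) :
    ∃ B ∈ CS v d p, (B ^ p)⁻¹ * A ∈ CS (v + 2) d p := by
  obtain ⟨X, hX⟩ := mem_CS_iff_exists.1 hA
  obtain ⟨C, hC⟩ := exists_one_add_smul_pow_prime hv hp X
  obtain ⟨B, hB, hBX⟩ := exists_mem_CS hv X
  refine ⟨B, hB, inv_mul_mem_CS_iff.2 ⟨-C, ?_⟩⟩
  rw [Units.val_pow_eq_pow_val, hBX, hC, hX, smul_neg, add_neg_cancel_right]

theorem commutator_mem_CS {i : ℕ} {A B : GL (Fin d) ℤ_[p]} (hA : A ∈ CS i d p)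
    (hB : B ∈ CS i d p) : A * B * A⁻¹ * B⁻¹ ∈ CS (i + i) d p := by
  obtain ⟨X, hX⟩ := mem_CS_iff_exists.1 hA
  obtain ⟨Y, hY⟩ := mem_CS_iff_exists.1 hB
  have h1 : (B * A)⁻¹ * (A * B) ∈ CS (i + i) d p := by
    refine inv_mul_mem_CS_iff.2 ⟨X * Y - Y * X, ?_⟩
    rw [Units.val_mul, Units.val_mul, hX, hY]
    simp only [mul_add, add_mul, mul_one, one_mul, smul_mul_smul_comm, ← pow_add, smul_sub]
    abel
  have hn : (CS (i + i) d p).Normal := MonoidHom.normal_ker _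
  have := hn.conj_mem _ h1 (B * A)
  rwa [show B * A * ((B * A)⁻¹ * (A * B)) * (B * A)⁻¹ = A * B * A⁻¹ * B⁻¹ by group] at this

/-- Modulo `p ^ (u + 1)`, multiplying matrices `1 + p ^ u B` adds the `B`. So the `B` realised in
`H` up to this precision form the additive monoid `T`, and it is enough that `T` contains all
multiples of matrix units. -/
theorem CS_le_of_single_mem {H : Subgroup (GL (Fin d) ℤ_[p])} (hu : 1 ≤ u)
    (hH : CS (u + 1) d p ≤ H)
    (hs : ∀ r c, ∃ A ∈ H, A.1 = 1 + (p : ℤ_[p]) ^ u • Matrix.single r c (1 : ℤ_[p])) :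
    CS u d p ≤ H := by
  let T : AddSubmonoid (Matrix (Fin d) (Fin d) ℤ_[p]) :=
    { carrier := {B | ∃ A ∈ H, ∃ C, A.1 = 1 + (p : ℤ_[p]) ^ u • B + (p : ℤ_[p]) ^ (u + 1) • C}
      zero_mem' := ⟨1, H.one_mem, 0, by simp⟩
      add_mem' := by
        rintro B B' ⟨A, hA, C, hC⟩ ⟨A', hA', C', hC'⟩
        refine ⟨A * A', H.mul_mem hA hA', ?_⟩
        obtain ⟨w, rfl⟩ := Nat.exists_eq_add_of_le hu
        refine ⟨C + C' + (p : ℤ_[p]) ^ w • ((B + (p : ℤ_[p]) • C) * (B' + (p : ℤ_[p]) • C')), ?_⟩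
        have e : ∀ B C : Matrix (Fin d) (Fin d) ℤ_[p], 1 + (p : ℤ_[p]) ^ (1 + w) • B +
            (p : ℤ_[p]) ^ (1 + w + 1) • C = 1 + (p : ℤ_[p]) ^ (1 + w) • (B + (p : ℤ_[p]) • C) := by
          intro B C
          rw [smul_add, smul_smul, ← pow_succ, add_assoc]
        rw [Units.val_mul, hC, hC', e, e]
        generalize hX : B + (p : ℤ_[p]) • C = X
        generalize hX' : B' + (p : ℤ_[p]) • C' = X'
        have e2 : (1 + (p : ℤ_[p]) ^ (1 + w) • X) * (1 + (p : ℤ_[p]) ^ (1 + w) • X') =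
            1 + (p : ℤ_[p]) ^ (1 + w) • X + (p : ℤ_[p]) ^ (1 + w) • X' +
            (p : ℤ_[p]) ^ (1 + w + 1) • (p : ℤ_[p]) ^ w • (X * X') := by
          simp only [mul_add, add_mul, mul_one, one_mul, smul_mul_smul_comm, smul_smul, ← pow_add]
          rw [show 1 + w + 1 + w = 1 + w + (1 + w) by ring]
          abel
        rw [e2, ← hX, ← hX']
        simp only [smul_add, smul_smul, ← pow_succ]
        abel }
  have hT1 : ∀ r c (x : ℤ_[p]), Matrix.single r c x ∈ T := by
    intro r c x
    have h1 : Matrix.single r c (1 : ℤ_[p]) ∈ T := by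
      obtain ⟨A, hA, hA1⟩ := hs r c
      exact ⟨A, hA, 0, by rw [hA1, smul_zero, add_zero]⟩
    -- Only `x` modulo `p` matters, so a natural multiple of the matrix unit suffices.
    obtain ⟨A, hA, C, hC⟩ := T.nsmul_mem h1 x.zmodRepr
    obtain ⟨y, hy⟩ : (p : ℤ_[p]) ∣ x - x.zmodRepr := by
      rw [← Ideal.mem_span_singleton, ← PadicInt.maximalIdeal_eq_span_p]
      exact PadicInt.sub_zmodRepr_mem x
    refine ⟨A, hA, C - Matrix.single r c y, ?_⟩
    have hx : Matrix.single r c x =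
        x.zmodRepr • Matrix.single r c (1 : ℤ_[p]) + (p : ℤ_[p]) • Matrix.single r c y := by
      rw [Matrix.smul_single, Matrix.smul_single, ← Matrix.single_add]
      congr 1
      rw [smul_eq_mul, ← hy]
      simp
    rw [hC, hx, smul_sub, smul_add, smul_smul, ← pow_succ]
    abel
  have hT : ∀ B, B ∈ T := by
    intro B
    rw [Matrix.matrix_eq_sum_single B]
    exact sum_mem fun r _ => sum_mem fun c _ => hT1 r c _
  intro A hA
  obtain ⟨B, hB⟩ := mem_CS_iff_exists.1 hA
  obtain ⟨A', hA', C, hC⟩ := hT B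
  have : A'⁻¹ * A ∈ H := hH (inv_mul_mem_CS_iff.2 ⟨-C, by
    rw [hC, hB, smul_neg, add_neg_cancel_right]⟩)
  simpa using H.mul_mem hA' this

end Congruence

/-! ### The filtration of `Γ` and its indices -/

section Gamma

variable {u d p : ℕ} [Fact p.Prime]

theorem mem_GamSub {j : ℕ} {g : Gam u d p} : g ∈ GamSub u d p j ↔ g.1 ∈ CS (u + j) d p :=
  Subgroup.mem_subgroupOf

theorem GamSub_antitone : Antitone (GamSub u d p) := fun _ _ h =>
  Subgroup.comap_mono (CS_anti (Nat.add_le_add_left h u))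

theorem GamSub_zero : GamSub u d p 0 = ⊤ := Subgroup.subgroupOf_self _

theorem pow_mem_GamSub (hu : 1 ≤ u) (hp : p = 2 → 2 ≤ u) {j : ℕ} {g : Gam u d p}
    (hg : g ∈ GamSub u d p j) : g ^ p ∈ GamSub u d p (j + 1) := by
  rw [mem_GamSub] at hg ⊢
  exact pow_mem_CS (v := u + j) (by omega) (fun h => by have := hp h; omega) hg

theorem pow_prime_pow_mem_GamSub (hu : 1 ≤ u) (hp : p = 2 → 2 ≤ u) (g : Gam u d p) (j : ℕ) :
    g ^ p ^ j ∈ GamSub u d p j := by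
  induction j with
  | zero => rw [GamSub_zero]; trivial
  | succ j ih => rw [pow_succ, pow_mul]; exact pow_mem_GamSub hu hp ih

theorem exists_pow_inv_mul_mem_GamSub (hu : 1 ≤ u) (hp : p = 2 → 2 ≤ u) {j : ℕ} {g : Gam u d p}
    (hg : g ∈ GamSub u d p (j + 1)) :
    ∃ h ∈ GamSub u d p j, (h ^ p)⁻¹ * g ∈ GamSub u d p (j + 2) := by
  rw [mem_GamSub, ← add_assoc] at hg
  obtain ⟨B, hB, hBg⟩ := exists_pow_inv_mul_mem_CS (v := u + j) (by omega)
    (fun h => by have := hp h; omega) hg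
  refine ⟨⟨B, CS_anti (Nat.le_add_right u j) hB⟩, mem_GamSub.2 hB, ?_⟩
  rw [mem_GamSub, ← add_assoc]
  exact hBg

theorem commutator_mem_GamSub (g h : Gam u d p) : g * h * g⁻¹ * h⁻¹ ∈ GamSub u d p u := by
  rw [mem_GamSub]
  exact commutator_mem_CS g.2 h.2

/-- `Γ` contains the elements `1 + p ^ u E`, for all matrix units `E`. -/
theorem exists_elementary (hu : 1 ≤ u) (r c : Fin d) :
    ∃ g : Gam u d p, g.1.1 = 1 + (p : ℤ_[p]) ^ u • Matrix.single r c (1 : ℤ_[p]) := by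
  obtain ⟨A, hA, h⟩ := exists_mem_CS hu (Matrix.single r c (1 : ℤ_[p]))
  exact ⟨⟨A, hA⟩, h⟩

theorem eq_top_of_elementary_mem (hu : 1 ≤ u) {H : Subgroup (Gam u d p)}
    (hH : GamSub u d p 1 ≤ H) {g : Fin d → Fin d → Gam u d p}
    (hg : ∀ r c, (g r c).1.1 = 1 + (p : ℤ_[p]) ^ u • Matrix.single r c (1 : ℤ_[p]))
    (hgH : ∀ r c, g r c ∈ H) : H = ⊤ := by
  have h1 : CS (u + 1) d p ≤ H.map (CS u d p).subtype := fun A hA =>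
    ⟨⟨A, CS_anti (Nat.le_add_right u 1) hA⟩, hH (mem_GamSub.2 hA), rfl⟩
  have h2 := CS_le_of_single_mem hu h1
    fun r c => ⟨(g r c).1, ⟨g r c, hgH r c, rfl⟩, hg r c⟩
  refine top_le_iff.1 fun x _ => ?_
  obtain ⟨y, hy, hxy⟩ := h2 x.2
  rwa [← Subtype.ext hxy]

/-- Writing `g = 1 + p ^ u B`, the coset of `g` is determined by `B` modulo `p ^ j`, and every
matrix over `ZMod (p ^ j)` occurs. -/
theorem card_quotient_GamSub (hu : 1 ≤ u) (j : ℕ) :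
    Nat.card (Gam u d p ⧸ GamSub u d p j) = (p ^ j) ^ (d * d) := by
  have hp0 : (p : ℤ_[p]) ≠ 0 := Nat.cast_ne_zero.2 (Fact.out : p.Prime).ne_zero
  choose B hB using fun g : Gam u d p => mem_CS_iff_exists.1 g.2
  let φ : Gam u d p → Matrix (Fin d) (Fin d) (ZMod (p ^ j)) :=
    fun g => (B g).map (PadicInt.toZModPow j)
  have hφ : ∀ g g', QuotientGroup.leftRel (GamSub u d p j) g g' ↔ φ g = φ g' := by
    intro g g'
    rw [QuotientGroup.leftRel_apply, mem_GamSub]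
    change (g.1⁻¹ * g'.1) ∈ _ ↔ _
    rw [inv_mul_mem_CS_iff, hB, hB]
    constructor
    · rintro ⟨C, hC⟩
      have hBC : B g' = B g + (p : ℤ_[p]) ^ j • C := by
        rw [add_assoc, add_right_inj, pow_add, mul_smul, ← smul_add] at hC
        exact smul_right_injective _ (pow_ne_zero u hp0) hC
      ext r c
      have h0 : PadicInt.toZModPow j ((p : ℤ_[p]) ^ j * C r c) = 0 := by
        rw [← RingHom.mem_ker, PadicInt.ker_toZModPow]
        exact Ideal.mem_span_singleton.2 ⟨_, rfl⟩
      simp only [φ, hBC, Matrix.map_apply, Matrix.add_apply, Matrix.smul_apply, smul_eq_mul]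
      rw [map_add, h0, add_zero]
    · intro h
      have : ∀ r c, ∃ x, B g' r c - B g r c = (p : ℤ_[p]) ^ j * x := by
        intro r c
        have h1 := congrFun (congrFun h r) c
        simp only [φ, Matrix.map_apply] at h1
        rw [← sub_eq_zero, ← map_sub, ← RingHom.mem_ker, PadicInt.ker_toZModPow,
          Ideal.mem_span_singleton] at h1
        obtain ⟨x, hx⟩ := h1
        exact ⟨-x, by rw [mul_neg, ← hx, neg_sub]⟩
      choose C hC using this
      refine ⟨Matrix.of C, ?_⟩
      have hBC : B g' = B g + (p : ℤ_[p]) ^ j • Matrix.of C := by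
        ext r c
        rw [Matrix.add_apply, Matrix.smul_apply, Matrix.of_apply, smul_eq_mul, ← hC]
        ring
      rw [hBC, smul_add, smul_smul, pow_add, add_assoc]
  have hsurj : Function.Surjective φ := by
    intro M
    choose f hf using ZMod.ringHom_surjective (PadicInt.toZModPow (p := p) j)
    obtain ⟨A, hA, hAM⟩ := exists_mem_CS hu (M.map f)
    refine ⟨⟨A, hA⟩, ?_⟩
    have : B ⟨A, hA⟩ = M.map f := by
      have h := hB ⟨A, hA⟩
      rw [hAM, add_right_inj] at h
      exact (smul_right_injective _ (pow_ne_zero u hp0) h).symm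
    ext r c
    simp [φ, this, hf]
  have e : Gam u d p ⧸ GamSub u d p j ≃ Matrix (Fin d) (Fin d) (ZMod (p ^ j)) :=
    (Quotient.congrRight hφ).trans (Setoid.quotientKerEquivOfSurjective φ hsurj)
  rw [Nat.card_congr e]
  change Nat.card (Fin d → Fin d → ZMod (p ^ j)) = _
  simp [pow_mul]

end Gamma

/-! ### The tower of group algebras and a uniform leading form -/

section Tower

open MonoidAlgebra (of)

variable {u d p : ℕ} [Fact p.Prime] {k : Type*} [Field k]

/-- In characteristic `p`, `h ^ p - 1 = (h - 1) ^ p`, so `p`-th powers multiply depth by `p`. An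
element of `Γ_{i+2}` is a `p`-th power from `Γ_{i+1}` up to an element of `Γ_{i+3}`, and the
correction is pushed on until it is trivial in the quotient. -/
theorem mk_mem_dimensionSubgroup [CharP k p] (hu : 1 ≤ u) (hp : p = 2 → 2 ≤ u) (n i : ℕ)
    {g : Gam u d p} (hg : g ∈ GamSub u d p i) :
    QuotientGroup.mk' (GamSub u d p n) g ∈
      dimensionSubgroup k (Gam u d p ⧸ GamSub u d p n) (p ^ i) := by
  induction i generalizing g with
  | zero => rw [pow_zero]; exact mem_dimensionSubgroup.2 (of_sub_one_mem _)
  | succ i IH =>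
    -- `t` bounds the number of corrections left before `GamSub u d p n` is reached.
    suffices H : ∀ t j, i + 1 ≤ j → n ≤ j + t → ∀ g ∈ GamSub u d p j,
        QuotientGroup.mk' (GamSub u d p n) g ∈
          dimensionSubgroup k (Gam u d p ⧸ GamSub u d p n) (p ^ (i + 1)) from
      H n (i + 1) le_rfl (Nat.le_add_left _ _) g hg
    intro t
    induction t with
    | zero =>
      intro j _ hj g hg
      rw [QuotientGroup.mk'_apply, (QuotientGroup.eq_one_iff g).2 (GamSub_antitone hj hg)]
      exact one_mem _
    | succ t ih =>
      intro j hij hj g hg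
      obtain ⟨j, rfl⟩ : ∃ j', j = j' + 1 := ⟨j - 1, by omega⟩
      obtain ⟨h, hh, hr⟩ := exists_pow_inv_mul_mem_GamSub hu hp hg
      have h1 := mem_dimensionSubgroup.1 (IH (GamSub_antitone (by omega : i ≤ j) hh))
      have h2 := augFiltration_pow_mem h1 p
      have h3 := MonoidAlgebra.of_sub_one_pow_char k p (QuotientGroup.mk' (GamSub u d p n) h) 1
      rw [pow_one] at h3
      rw [h3, ← pow_succ] at h2
      have h4 := mul_mem (mem_dimensionSubgroup.2 h2) (ih (j + 2) (by omega) (by omega) _ hr)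
      rwa [← map_pow, ← map_mul, mul_inv_cancel_left] at h4

theorem augFiltration_quotient_almostComm [CharP k p] (hu : 1 ≤ u) (hp : p = 2 → 2 ≤ u)
    {g : Fin d ×ₗ Fin d → Gam u d p}
    (hg : ∀ i, (g i).1.1 = 1 + (p : ℤ_[p]) ^ u • Matrix.single (ofLex i).1 (ofLex i).2 (1 : ℤ_[p]))
    (n : ℕ) :
    AlmostCommFiltration (augFiltration k (Gam u d p ⧸ GamSub u d p n))
      (fun i => of k _ (QuotientGroup.mk' (GamSub u d p n) (g i)) - 1) := by
  have hp2 := (Fact.out : p.Prime).two_le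
  refine augFiltration_almostComm (fun i j => ?_) fun V hV hgV => ?_
  -- Commutators lie in `GamSub u d p u`, hence in depth `p ^ u`; reaching depth 3 when `p = 2`
  -- requires `u ≥ 2`.
  · have h3 : 3 ≤ p ^ u := by
      by_cases h : p = 2
      · subst h
        exact le_trans (by norm_num) (Nat.pow_le_pow_right two_pos (hp rfl))
      · exact le_trans (by omega) (Nat.le_self_pow (by omega : u ≠ 0) p)
    have := mk_mem_dimensionSubgroup (k := k) hu hp n u (commutator_mem_GamSub (g i) (g j))
    simp only [map_mul, map_inv] at this
    exact augFiltration_antitone h3 this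
  · have htop : V.comap (QuotientGroup.mk' (GamSub u d p n)) = ⊤ := by
      refine eq_top_of_elementary_mem hu (fun x hx => hV ?_) (g := fun r c => g (toLex (r, c)))
        (fun r c => hg _) fun r c => hgV _
      have := mk_mem_dimensionSubgroup (k := k) hu hp n 1 hx
      rw [pow_one] at this
      exact augFiltration_antitone hp2 this
    refine top_le_iff.1 fun x _ => ?_
    obtain ⟨y, rfl⟩ := QuotientGroup.mk'_surjective _ x
    have hy : y ∈ V.comap (QuotientGroup.mk' (GamSub u d p n)) := htop ▸ Subgroup.mem_top y
    exact hy

theorem of_mk_sub_one_pow_eq_zero [CharP k p] (hu : 1 ≤ u) (hp : p = 2 → 2 ≤ u) (n : ℕ)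
    (g : Gam u d p) : (of k _ (QuotientGroup.mk' (GamSub u d p n) g) - 1) ^ p ^ n = 0 := by
  rw [MonoidAlgebra.of_sub_one_pow_char, ← map_pow, QuotientGroup.mk'_apply,
    (QuotientGroup.eq_one_iff _).2 (pow_prime_pow_mem_GamSub hu hp g n), map_one, sub_self]

theorem finite_quotient_GamSub (hu : 1 ≤ u) (n : ℕ) : Finite (Gam u d p ⧸ GamSub u d p n) :=
  Nat.finite_of_card_ne_zero <| by
    rw [card_quotient_GamSub hu]
    exact pow_ne_zero _ (pow_ne_zero _ (Fact.out : p.Prime).ne_zero)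

theorem isPGroup_quotient_GamSub (hu : 1 ≤ u) (n : ℕ) :
    IsPGroup p (Gam u d p ⧸ GamSub u d p n) :=
  IsPGroup.of_card (n := n * (d * d)) (by rw [card_quotient_GamSub hu, ← pow_mul])

/-- The transition map `Γ / Γ_{j+1} → Γ / Γ_{i+1}`. -/
noncomputable def quotTransition {i j : ℕ} (h : i ≤ j) :
    Gam u d p ⧸ GamSub u d p j →* Gam u d p ⧸ GamSub u d p i :=
  QuotientGroup.map _ _ (MonoidHom.id _) (GamSub_antitone h)

theorem quotTransition_surjective {i j : ℕ} (h : i ≤ j) :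
    Function.Surjective (quotTransition (u := u) (d := d) (p := p) h) := by
  intro x
  obtain ⟨g, rfl⟩ := QuotientGroup.mk'_surjective _ x
  exact ⟨QuotientGroup.mk' _ g, rfl⟩

theorem ker_quotTransition_le [CharP k p] (hu : 1 ≤ u) (hp : p = 2 → 2 ≤ u) {i j : ℕ}
    (h : i ≤ j) : (quotTransition (u := u) (d := d) (p := p) h).ker ≤
      dimensionSubgroup k (Gam u d p ⧸ GamSub u d p j) (p ^ i) := by
  intro x hx
  obtain ⟨g, rfl⟩ := QuotientGroup.mk'_surjective _ x
  exact mk_mem_dimensionSubgroup hu hp j i ((QuotientGroup.eq_one_iff g).1 hx)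

theorem mapDomain_quotTransition_completedProj {i j : ℕ} (h : i ≤ j)
    (a : CompletedGroupRing u d p k) :
    MonoidAlgebra.mapDomain (quotTransition h) (completedProj j a) = completedProj i a := by
  obtain ⟨b, hb⟩ := RingCon.mk'_surjective (relAugIdeal k (GamSub u d p j)).ringCon (a.1 j)
  have hi := a.2 i j h
  rw [← hb] at hi
  change MonoidAlgebra.mapDomain _ (quotToGroupRing k (GamSub u d p j) (a.1 j)) =
    quotToGroupRing k (GamSub u d p i) (a.1 i)
  rw [← hi, ← hb]
  change MonoidAlgebra.mapDomain _ (MonoidAlgebra.mapDomain _ b) = MonoidAlgebra.mapDomain _ b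
  exact (RingHom.congr_fun (MonoidAlgebra.mapDomainRingHom_comp (R := k) (quotTransition h)
    (QuotientGroup.mk' (GamSub u d p j))) b).symm

/-- Ensures that a nonzero element of the completed group ring is nonzero in some `k[Γ / Γ_n]`. -/
theorem quotToGroupRing_injective {G : Type*} [Group G] (N : Subgroup G) [N.Normal] :
    Function.Injective (quotToGroupRing k N) := by
  refine (injective_iff_map_eq_zero _).2 fun x hx => ?_
  obtain ⟨b, rfl⟩ := RingCon.mk'_surjective _ x
  have hb : MonoidAlgebra.mapDomain (QuotientGroup.mk' N) b = 0 := hx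
  let V : AddSubmonoid (MonoidAlgebra k G) :=
    { carrier := {x | x ∈ relAugIdeal k N}
      zero_mem' := (relAugIdeal k N).zero_mem
      add_mem' := (relAugIdeal k N).add_mem }
  have hbV : b ∈ V := by
    refine MonoidAlgebra.mem_of_mapDomain_eq_zero (fun g g' r h => ?_) hb
    have hn : g'⁻¹ * g ∈ N := QuotientGroup.eq.1 (h.symm : (g' : G ⧸ N) = g)
    have h1 : MonoidAlgebra.mapDomainRingHom k N.subtype (of k N ⟨g'⁻¹ * g, hn⟩ - 1) ∈
        relAugIdeal k N := by
      refine TwoSidedIdeal.subset_span ⟨_, (TwoSidedIdeal.mem_ker _).2 ?_, rfl⟩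
      rw [map_sub (MonoidAlgebra.lift k k N 1), map_one (MonoidAlgebra.lift k k N 1),
        MonoidAlgebra.lift_of, MonoidHom.one_apply, sub_self]
    have h2 := (relAugIdeal k N).mul_mem_left (MonoidAlgebra.single g' r) _ h1
    have h3 : MonoidAlgebra.single g r - MonoidAlgebra.single g' r = MonoidAlgebra.single g' r *
        MonoidAlgebra.mapDomainRingHom k N.subtype (of k N ⟨g'⁻¹ * g, hn⟩ - 1) := by
      rw [map_sub, map_one]
      simp [mul_sub, MonoidAlgebra.single_mul_single]
    rw [h3]
    exact h2
  exact (RingCon.eq _).2 hbV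

theorem exists_completedProj_ne_zero {a : CompletedGroupRing u d p k} (ha : a ≠ 0) :
    ∃ j, completedProj j a ≠ 0 := by
  by_contra! h
  refine ha (Subtype.ext (funext fun j => quotToGroupRing_injective (GamSub u d p j) ?_))
  rw [ZeroMemClass.coe_zero, Pi.zero_apply, map_zero]
  exact h j

theorem map_orderedMonomial {A B ι : Type*} [Ring A] [Ring B] [Algebra k A] [Algebra k B]
    (f : A →ₐ[k] B) (x : ι → A) (s : ι →₀ ℕ) :
    f (orderedMonomial x s) = orderedMonomial (fun i => f (x i)) s := by
  rw [orderedMonomial, orderedMonomial, map_list_prod, List.map_map]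
  rfl

theorem exists_finrank_ker_inducedLeftMul_le [CharP k p] (hu : 1 ≤ u) (hp : p = 2 → 2 ≤ u)
    {a : CompletedGroupRing u d p k} (ha : a ≠ 0) :
    ∃ m j₀, ∀ j, j₀ ≤ j → Module.finrank k (LinearMap.ker (inducedLeftMul a j)) ≤
      m * (p ^ j) ^ (d * d - 1) := by
  have hp2 := (Fact.out : p.Prime).two_le
  have hfin : ∀ n, Finite (Gam u d p ⧸ GamSub u d p n) := finite_quotient_GamSub hu
  have hnil := fun n => exists_augFiltration_eq_bot k p (isPGroup_quotient_GamSub (d := d) hu n)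
  choose g hg using fun i : Fin d ×ₗ Fin d => exists_elementary (p := p) hu (ofLex i).1 (ofLex i).2
  have hF := augFiltration_quotient_almostComm (k := k) hu hp hg
  obtain ⟨j₀, hj₀⟩ := exists_completedProj_ne_zero ha
  obtain ⟨N, hN⟩ := hnil j₀
  -- Since `a` is nonzero at level `j₀`, where depth `N` is zero, its depth `m` at level `j₁` is
  -- below `N`. Taking `j₁ ≥ N` gives `m < N ≤ j₁ < p ^ j₁`.
  obtain ⟨j₁, hj₁⟩ : ∃ j₁, j₁ = max j₀ N := ⟨_, rfl⟩
  have h01 : j₀ ≤ j₁ := hj₁ ▸ le_max_left _ _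
  have hmap : ∀ {i j : ℕ} (h : i ≤ j), MonoidAlgebra.mapDomainAlgHom k k (quotTransition h)
      (completedProj j a) = completedProj i a := fun h =>
    mapDomain_quotTransition_completedProj h a
  have hnot : completedProj j₁ a ∉ augFiltration k _ N := by
    intro h
    have := Submodule.mem_map_of_mem
      (f := (MonoidAlgebra.mapDomainAlgHom k k (quotTransition h01)).toLinearMap) h
    rw [augFiltration_map (quotTransition_surjective h01), hN, Submodule.mem_bot] at this
    exact hj₀ ((hmap h01).symm.trans this)
  obtain ⟨m, hmN, hm, hm'⟩ : ∃ m < N, completedProj j₁ a ∈ augFiltration k _ m ∧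
      completedProj j₁ a ∉ augFiltration k _ (m + 1) := by
    classical
    have hex : ∃ n, completedProj j₁ a ∉ augFiltration k _ n := ⟨N, hnot⟩
    have h0 : Nat.find hex ≠ 0 := by
      intro h
      have := Nat.find_spec hex
      rw [h, augFiltration_zero] at this
      exact this trivial
    have h1 := Nat.find_min' hex hnot
    refine ⟨Nat.find hex - 1, by omega, not_not.1 (Nat.find_min hex (by omega)), ?_⟩
    rw [Nat.sub_add_cancel (by omega)]
    exact Nat.find_spec hex
  obtain ⟨c, hc, hac⟩ := (hF j₁).exists_leadingForm hm
  have hc0 : c ≠ 0 := by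
    rintro rfl
    rw [Finsupp.sum_zero_index, sub_zero] at hac
    exact hm' hac
  refine ⟨m, j₁, fun j hj => ?_⟩
  obtain ⟨N', hN'⟩ := hnil j
  have hlead : completedProj j a - c.sum (fun s r => r • orderedMonomial
      (fun i => of k _ (QuotientGroup.mk' (GamSub u d p j) (g i)) - 1) s) ∈
      augFiltration k _ (m + 1) := by
    -- Lift the error term at level `j₁` to some `y` of depth `m + 1` at level `j`. The error at
    -- level `j` differs from `y` by an element that dies at level `j₁`, hence of depth at least `p
    -- ^ j₁ ≥ m + 1`.
    rw [← augFiltration_map (quotTransition_surjective hj)] at hac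
    obtain ⟨y, hy, hya⟩ := hac
    refine (Submodule.sub_mem_iff_left _ hy).1 (augFiltration_antitone
      (le_trans (by omega) (Nat.lt_pow_self hp2).le : m + 1 ≤ p ^ j₁)
      (ker_mapDomain_le_augFiltration (ker_quotTransition_le hu hp hj) ?_))
    change MonoidAlgebra.mapDomainAlgHom k k (quotTransition hj) _ = 0
    rw [map_sub, sub_eq_zero]
    refine Eq.trans ?_ hya.symm
    rw [map_sub, hmap, map_finsuppSum]
    congr 1
    refine Finsupp.sum_congr fun s _ => ?_
    rw [map_smul, map_orderedMonomial]
    congr 2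
    funext i
    rw [map_sub, map_one]
    congr 1
    exact MonoidAlgebra.mapDomain_single
  have hfd : FiniteDimensional k (MonoidAlgebra k (Gam u d p ⧸ GamSub u d p j)) := inferInstance
  -- The index type is `Fin d ×ₗ Fin d` so that it has the linear order used by `MonomialOrder.lex`.
  have := (hF j).finrank_ker_mulLeft_le MonomialOrder.lex hN'
    (fun i => of_mk_sub_one_pow_eq_zero hu hp j (g i)) hc hlead hc0
  rwa [Fintype.card_lex, Fintype.card_prod, Fintype.card_fin] at this

end Tower

theorem lemma5p2 (u d p : ℕ) [Fact p.Prime] (hu : 1 ≤ u) (hd : 1 ≤ d) (hp : p = 2 → 2 ≤ u)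
    (k : Type*) [Field k] [CharP k p] (a : CompletedGroupRing u d p k) (ha : a ≠ 0) :
    Filter.Tendsto
      (fun j : ℕ => (Module.finrank k (LinearMap.ker (inducedLeftMul a j)) : ℝ) /
        ((GamSub u d p j).index : ℝ))
      Filter.atTop (nhds 0) := by
  have hp2 := (Fact.out : p.Prime).two_le
  obtain ⟨m, j₀, h⟩ := exists_finrank_ker_inducedLeftMul_le hu hp ha
  have hp1 : (1 : ℝ) < p := by exact_mod_cast hp2
  have hlim : Filter.Tendsto (fun j : ℕ => (m : ℝ) * ((p : ℝ)⁻¹) ^ j) Filter.atTop (nhds 0) := by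
    simpa using (tendsto_pow_atTop_nhds_zero_of_lt_one (by positivity)
      (inv_lt_one_of_one_lt₀ hp1)).const_mul (m : ℝ)
  refine squeeze_zero' (Filter.Eventually.of_forall fun j => by positivity) ?_ hlim
  filter_upwards [Filter.eventually_ge_atTop j₀] with j hj
  have hq : (0 : ℝ) < (p : ℝ) ^ j := by positivity
  -- Positivity of `d` makes the natural subtraction exact, so the quotient of the bound by the
  -- index is `m * p⁻¹ ^ j`.
  have hD : d * d = d * d - 1 + 1 := (Nat.sub_add_cancel (Nat.mul_pos hd hd)).symm
  rw [Subgroup.index, card_quotient_GamSub hu, hD, div_le_iff₀ (by positivity)]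
  refine (Nat.cast_le.2 (h j hj)).trans (le_of_eq ?_)
  push_cast
  rw [pow_succ, inv_pow]
  field_simp
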